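/- For an integer $p\ge 1$ and $c\in\mathbb{R}$ consider real-valued solutions, $2\pi$-periodic in each of the variables $x$ and $y$, of $$-\Delta\varphi+c\,\varphi-\varphi^{p+1}=0\quad\text{on }\mathbb{R}^2. \qquad (1)$$ Call $\varphi$ even if $\varphi(-x,-y)=\varphi(x,y)$. For families of functions, $\mathcal{O}(a^k)$ means bounded by a constant times $a^k$ both uniformly in $(x,y)$ and in the norm of $H^2$ over the period cell $[0,2\pi]^2$, for all $a\in(0,a_0)$; the constant and $a_0$ may depend on $p$ only. (i) Let $p=1$. There is $a_0>0$ such that for every $a\in(0,a_0)$ there are a frequency $c=c(a)$ and two distinct smooth, even, doubly $2\pi$-periodic solutions $\varphi_+$ and $\varphi_-$ of (1), both with this same frequency $c$, such that $$\varphi_\pm(x,y)=2+a\cos(x\pm y)+\frac{a^2}{6}\Bigl(1+\frac12\cos(2x\pm2y)\Bigr)+\frac{a^3}{192}\cos(3x\pm3y)+\mathcal{O}(a^4),$$ $$c=2+\frac{5}{12}a^2+\mathcal{O}(a^4).$$ (ii) Let $p\ge 2$. There is $a_0>0$ such that for every $a\in(0,a_0)$ there are a frequency $c=c(a)$ and two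 distinct smooth, even, doubly $2\pi$-periodic solutions $\varphi_+$ and $\varphi_-$ of (1), both with this same frequency $c$, such that $$\varphi_\pm(x,y)=\Bigl(\frac2p\Bigr)^{1/p}+a\cos(x\pm y)+\Bigl(\frac{c_2}{2}\Bigl(\frac2p\Bigr)^{1/p}-\frac14\Bigl(\frac2p\Bigr)^{(p-1)/p}\binom{p+1}{2}\Bigr)a^2+\frac{p(p+1)}{24}\Bigl(\frac2p\Bigr)^{(p-1)/p}a^2\cos(2x\pm2y)+\mathcal{O}(a^3),$$ $$c=\frac2p+c_2a^2+\mathcal{O}(a^4),\qquad c_2=\frac{5}{48}\,p(p+1)^2\Bigl(\frac2p\Bigr)^{2(p-1)/p}-\frac18(p-1)(p+1)\Bigl(\frac2p\Bigr)^{(p-2)/p}.$$ -/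

import Mathlib

open scoped ContDiff

noncomputable section

/-- The plane `ℝ²` with its Euclidean structure. Functions on the torus `𝕋 × 𝕋` are functions on the
plane that are `2π`-periodic in both variables; `z 0` is the variable `x` and `z 1` is `y`. -/
abbrev Plane : Type := EuclideanSpace ℝ (Fin 2)

/-- `φ` is `2π`-periodic in each of the two variables. -/
def IsDoublyPeriodic (φ : Plane → ℝ) : Prop :=
  ∀ (i : Fin 2) (z : Plane), φ (z + EuclideanSpace.single i (2 * Real.pi)) = φ z

/-- `φ` is an even, smooth, doubly `2π`-periodic, real-valued solution of
`-Δ φ + c φ - φ ^ (p + 1) = 0`, where `Δ` is Mathlib's Laplacian on the plane. -/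
structure IsEvenPeriodicWave (p : ℕ) (c : ℝ) (φ : Plane → ℝ) : Prop where
  smooth : ContDiff ℝ ∞ φ
  periodic : IsDoublyPeriodic φ
  even : ∀ z : Plane, φ (-z) = φ z
  equation : ∀ z : Plane, -(Laplacian.laplacian φ z) + c * φ z - φ z ^ (p + 1) = 0

/-- The periodicity cell `[0, 2π] × [0, 2π]`. -/
def periodCell : Set Plane := {z | ∀ i, z i ∈ Set.Icc 0 (2 * Real.pi)}

/-- The Sobolev norm of `H²(𝕋 × 𝕋)` of a smooth doubly `2π`-periodic function: the root of the
integral of `|f|² + |D f|² + |D² f|²` over one periodicity cell. -/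
def sobolevH2Norm (f : Plane → ℝ) : ℝ :=
  Real.sqrt (∑ k ∈ Finset.range 3,
    ∫ z in periodCell, ‖iteratedFDeriv ℝ k f z‖ ^ 2 ∂MeasureTheory.volume)

/-- `f` is at most `δ` in absolute value everywhere, and also in the norm of `H²(𝕋 × 𝕋)`. -/
def IsWithin (f : Plane → ℝ) (δ : ℝ) : Prop :=
  (∀ z : Plane, |f z| ≤ δ) ∧ sobolevH2Norm f ≤ δ

/-- The expansion, for the power `p = 1`, up to order `a³`, with phase `x + σ y`, `σ = ± 1`. -/
def expansionOne (σ a : ℝ) (z : Plane) : ℝ :=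
  2 + a * Real.cos (z 0 + σ * z 1)
    + a ^ 2 / 6 * (1 + 1 / 2 * Real.cos (2 * z 0 + σ * (2 * z 1)))
    + 1 / 192 * a ^ 3 * Real.cos (3 * z 0 + σ * (3 * z 1))

/-- The coefficient of `a²` in the frequency for a general power `p`. -/
def frequencyCoeff (p : ℕ) : ℝ :=
  5 / 48 * (p : ℝ) * ((p : ℝ) + 1) ^ 2 * (2 / (p : ℝ)) ^ (2 * ((p : ℝ) - 1) / (p : ℝ))
    - 1 / 8 * ((p : ℝ) - 1) * ((p : ℝ) + 1) * (2 / (p : ℝ)) ^ (((p : ℝ) - 2) / (p : ℝ))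

/-- The expansion, for a general power `p`, up to order `a²`, with phase `x + σ y`, `σ = ± 1`. -/
def expansionGen (p : ℕ) (σ a : ℝ) (z : Plane) : ℝ :=
  (2 / (p : ℝ)) ^ (1 / (p : ℝ)) + a * Real.cos (z 0 + σ * z 1)
    + (frequencyCoeff p / 2 * (2 / (p : ℝ)) ^ (1 / (p : ℝ))
        - 1 / 4 * (2 / (p : ℝ)) ^ (((p : ℝ) - 1) / (p : ℝ)) * ((p + 1).choose 2 : ℝ)) * a ^ 2
    + (p : ℝ) * ((p : ℝ) + 1) / 24 * (2 / (p : ℝ)) ^ (((p : ℝ) - 1) / (p : ℝ)) * a ^ 2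
        * Real.cos (2 * z 0 + σ * (2 * z 1))

end

/-! The waves are one-dimensional: φ = u(x ± y) solves (1) exactly when 2u'' = cu − u^(p+1), so both
waves share u and c. The constant m with p·m^p = 2 solves this for c = m^p = 2/p. There the
linearisation is v'' + v = 0, whose even solutions are the multiples of cos, and a branch with
leading term a cos s bifurcates from m.

Put u = m + a(cos s + w) and c = m^p + aδ. After division by 2a the equation is w'' + w = ½(δm +
a·F), where F (`waveForcing`) collects δ(cos + w) and minus the nonlinear tail. Variation of
constants (`duhamel`) inverts f'' + f. For an even periodic source the result is periodic if the
cosine coefficient of the source vanishes. The constant δm does not contribute to it, so the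
condition becomes cosCoeff F = 0 with the factor a divided out, which makes the problem regular at a
= 0. In `waveMap` this condition is paired with the integral equation for w. The amplitude is
normalised by giving w(0) the value of the explicit approximation, rather than by fixing a Fourier
coefficient.

The (w, δ)-derivative of `waveMap` at the origin is onto because its reduced scalar is −p ≠ 0
(`fderiv_waveMap_surjective`). The explicit trigonometric polynomial with δ = c₂a leaves a residual
O(a³) (`waveSource_approx`, `cosCoeff_waveForcing_approx`), so an exact zero lies at distance O(a³)
(`exists_zero_near_approximate_zero`). The prefactor a in u and c turns this into O(a⁴). The error
solves the same linear equation with a source of size O(a³), which also controls two derivatives and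
hence the H² norm. -/

open scoped ContDiff

/-! ### Variation of constants for f'' + f = h -/

/-- The solution of `f'' + f = h` with vanishing initial data, by variation of constants. -/
noncomputable def duhamel (h : ℝ → ℝ) (s : ℝ) : ℝ :=
  Real.sin s * (∫ t in (0 : ℝ)..s, Real.cos t * h t) -
    Real.cos s * ∫ t in (0 : ℝ)..s, Real.sin t * h t

/-- The derivative of `duhamel h`. -/
noncomputable def duhamelDeriv (h : ℝ → ℝ) (s : ℝ) : ℝ :=
  Real.cos s * (∫ t in (0 : ℝ)..s, Real.cos t * h t) +
    Real.sin s * ∫ t in (0 : ℝ)..s, Real.sin t * h t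

theorem hasDerivAt_integral_mul {g h : ℝ → ℝ} (hg : Continuous g) (hh : Continuous h) (s : ℝ) :
    HasDerivAt (fun s => ∫ t in (0 : ℝ)..s, g t * h t) (g s * h s) s := by
  have hgh : Continuous fun t => g t * h t := hg.mul hh
  exact intervalIntegral.integral_hasDerivAt_right (hgh.intervalIntegrable _ _)
    (hgh.stronglyMeasurableAtFilter _ _) hgh.continuousAt

theorem hasDerivAt_duhamel {h : ℝ → ℝ} (hh : Continuous h) (s : ℝ) :
    HasDerivAt (duhamel h) (duhamelDeriv h s) s := by
  have hc := hasDerivAt_integral_mul Real.continuous_cos hh s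
  have hs := hasDerivAt_integral_mul Real.continuous_sin hh s
  refine (((Real.hasDerivAt_sin s).mul hc).sub ((Real.hasDerivAt_cos s).mul hs)).congr_deriv ?_
  simp only [duhamelDeriv]
  ring

theorem hasDerivAt_duhamelDeriv {h : ℝ → ℝ} (hh : Continuous h) (s : ℝ) :
    HasDerivAt (duhamelDeriv h) (h s - duhamel h s) s := by
  have hc := hasDerivAt_integral_mul Real.continuous_cos hh s
  have hs := hasDerivAt_integral_mul Real.continuous_sin hh s
  refine (((Real.hasDerivAt_cos s).mul hc).add ((Real.hasDerivAt_sin s).mul hs)).congr_deriv ?_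
  simp only [duhamel]
  linear_combination h s * Real.sin_sq_add_cos_sq s

theorem continuous_duhamel {h : ℝ → ℝ} (hh : Continuous h) : Continuous (duhamel h) :=
  continuous_iff_continuousAt.2 fun s => (hasDerivAt_duhamel hh s).continuousAt

theorem duhamel_neg {h : ℝ → ℝ} (he : ∀ t, h (-t) = h t) (s : ℝ) :
    duhamel h (-s) = duhamel h s := by
  have hc : (∫ t in (0 : ℝ)..(-s), Real.cos t * h t) = -∫ t in (0 : ℝ)..s, Real.cos t * h t := by
    have := intervalIntegral.integral_comp_neg (a := 0) (b := s) fun t => Real.cos t * h t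
    simp only [Real.cos_neg, he, neg_zero] at this
    rw [this, intervalIntegral.integral_symm]
  have hs : (∫ t in (0 : ℝ)..(-s), Real.sin t * h t) = ∫ t in (0 : ℝ)..s, Real.sin t * h t := by
    have := intervalIntegral.integral_comp_neg (a := 0) (b := s) fun t => Real.sin t * h t
    simp only [Real.sin_neg, he, neg_zero, neg_mul, intervalIntegral.integral_neg] at this
    rw [intervalIntegral.integral_symm, ← this, neg_neg]
  simp only [duhamel, hc, hs, Real.sin_neg, Real.cos_neg]
  ring

theorem integral_add_period {g : ℝ → ℝ} (hg : Continuous g)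
    (hp : Function.Periodic g (2 * Real.pi)) (h0 : (∫ t in (0 : ℝ)..(2 * Real.pi), g t) = 0)
    (s : ℝ) : (∫ t in (0 : ℝ)..(s + 2 * Real.pi), g t) = ∫ t in (0 : ℝ)..s, g t := by
  rw [← intervalIntegral.integral_add_adjacent_intervals (hg.intervalIntegrable 0 s)
    (hg.intervalIntegrable s _), hp.intervalIntegral_add_eq s 0, zero_add, h0, add_zero]

/-- Periodicity needs both the sine and the cosine moment of `h` over a period to vanish. Evenness
already kills the sine moment, so one resonance condition remains. -/
theorem duhamel_periodic {h : ℝ → ℝ} (hh : Continuous h) (he : ∀ t, h (-t) = h t)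
    (hp : Function.Periodic h (2 * Real.pi))
    (hc : (∫ t in (0 : ℝ)..(2 * Real.pi), Real.cos t * h t) = 0) :
    Function.Periodic (duhamel h) (2 * Real.pi) := by
  have hsp : Function.Periodic (fun t => Real.sin t * h t) (2 * Real.pi) :=
    Real.sin_periodic.mul hp
  have hs : (∫ t in (0 : ℝ)..(2 * Real.pi), Real.sin t * h t) = 0 := by
    have h1 := hsp.intervalIntegral_add_eq 0 (-(2 * Real.pi))
    rw [zero_add, neg_add_cancel] at h1
    have h2 := intervalIntegral.integral_comp_neg (a := 0) (b := 2 * Real.pi)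
      fun t => Real.sin t * h t
    simp only [Real.sin_neg, he, neg_zero, neg_mul, intervalIntegral.integral_neg] at h2
    linarith
  intro s
  simp only [duhamel, Real.sin_add_two_pi, Real.cos_add_two_pi]
  rw [integral_add_period (g := fun t => Real.cos t * h t) (Real.continuous_cos.mul hh)
      (Real.cos_periodic.mul hp) hc,
    integral_add_period (g := fun t => Real.sin t * h t) (Real.continuous_sin.mul hh) hsp hs]

theorem abs_integral_mul_le {g h : ℝ → ℝ} {M : ℝ} (hg : ∀ t, |g t| ≤ 1) (hM : ∀ t, |h t| ≤ M)
    (s : ℝ) : |∫ t in (0 : ℝ)..s, g t * h t| ≤ M * |s| := by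
  have := intervalIntegral.norm_integral_le_of_norm_le_const (a := 0) (b := s) (C := M)
    (f := fun t => g t * h t) fun t _ => by
      rw [Real.norm_eq_abs, abs_mul]
      nlinarith [hg t, hM t, abs_nonneg (g t), abs_nonneg (h t)]
  simpa using this

theorem abs_duhamel_le {h : ℝ → ℝ} {M : ℝ} (hM : ∀ t, |h t| ≤ M) (s : ℝ) :
    |duhamel h s| ≤ 2 * M * |s| := by
  have h1 := abs_integral_mul_le Real.abs_cos_le_one hM s
  have h2 := abs_integral_mul_le Real.abs_sin_le_one hM s
  have h3 := mul_le_mul (Real.abs_sin_le_one s) h1 (abs_nonneg _) zero_le_one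
  have h4 := mul_le_mul (Real.abs_cos_le_one s) h2 (abs_nonneg _) zero_le_one
  rw [← abs_mul] at h3 h4
  exact (abs_sub _ _).trans (by linarith)

theorem abs_duhamelDeriv_le {h : ℝ → ℝ} {M : ℝ} (hM : ∀ t, |h t| ≤ M) (s : ℝ) :
    |duhamelDeriv h s| ≤ 2 * M * |s| := by
  have h1 := abs_integral_mul_le Real.abs_cos_le_one hM s
  have h2 := abs_integral_mul_le Real.abs_sin_le_one hM s
  have h3 := mul_le_mul (Real.abs_cos_le_one s) h1 (abs_nonneg _) zero_le_one
  have h4 := mul_le_mul (Real.abs_sin_le_one s) h2 (abs_nonneg _) zero_le_one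
  rw [← abs_mul] at h3 h4
  exact (abs_add_le _ _).trans (by linarith)

theorem duhamel_eq_of_hasDerivAt {f f' f'' : ℝ → ℝ} (h1 : ∀ t, HasDerivAt f (f' t) t)
    (h2 : ∀ t, HasDerivAt f' (f'' t) t) (hf : Continuous f'') (s : ℝ) :
    duhamel (fun t => f'' t + f t) s = f s - f 0 * Real.cos s - f' 0 * Real.sin s := by
  have hc : Continuous f := continuous_iff_continuousAt.2 fun t => (h1 t).continuousAt
  have e1 := intervalIntegral.integral_eq_sub_of_hasDerivAt (a := 0) (b := s)
    (f := fun t => Real.cos t * f' t + Real.sin t * f t)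
    (f' := fun t => Real.cos t * (f'' t + f t))
    (fun t _ => (((Real.hasDerivAt_cos t).mul (h2 t)).add
      ((Real.hasDerivAt_sin t).mul (h1 t))).congr_deriv (by ring))
    ((Real.continuous_cos.mul (hf.add hc)).intervalIntegrable _ _)
  have e2 := intervalIntegral.integral_eq_sub_of_hasDerivAt (a := 0) (b := s)
    (f := fun t => Real.sin t * f' t - Real.cos t * f t)
    (f' := fun t => Real.sin t * (f'' t + f t))
    (fun t _ => (((Real.hasDerivAt_sin t).mul (h2 t)).sub
      ((Real.hasDerivAt_cos t).mul (h1 t))).congr_deriv (by ring))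
    ((Real.continuous_sin.mul (hf.add hc)).intervalIntegrable _ _)
  simp only [duhamel, e1, e2, Real.sin_zero, Real.cos_zero]
  linear_combination f s * Real.sin_sq_add_cos_sq s

/-! ### Even periodic functions as a Banach algebra -/

/-- Continuous functions on `[-1, 1]`; `H` stands for the even `2π`-periodic function
`s ↦ H (cos s)`. -/
abbrev CosSpace : Type := C(Set.Icc (-1 : ℝ) 1, ℝ)

/-- The even `2π`-periodic function `s ↦ H (cos s)`. -/
noncomputable def onCircle (H : CosSpace) (s : ℝ) : ℝ := H ⟨Real.cos s, Real.cos_mem_Icc s⟩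

/-- The function on `[-1, 1]` that stands for the cosine. -/
def cosVar : CosSpace := ⟨Subtype.val, continuous_subtype_val⟩

section onCircle

variable (H H' : CosSpace) (s r : ℝ)

@[simp] theorem onCircle_add : onCircle (H + H') s = onCircle H s + onCircle H' s := rfl
@[simp] theorem onCircle_sub : onCircle (H - H') s = onCircle H s - onCircle H' s := rfl
@[simp] theorem onCircle_smul : onCircle (r • H) s = r * onCircle H s := rfl
@[simp] theorem onCircle_one : onCircle 1 s = 1 := rfl
@[simp] theorem onCircle_zero : onCircle 0 s = 0 := rfl
@[simp] theorem onCircle_cosVar : onCircle cosVar s = Real.cos s := rfl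
@[simp] theorem onCircle_pow (n : ℕ) : onCircle (H ^ n) s = onCircle H s ^ n := by
  simp [onCircle]
@[simp] theorem onCircle_sum {ι : Type*} (t : Finset ι) (F : ι → CosSpace) :
    onCircle (∑ i ∈ t, F i) s = ∑ i ∈ t, onCircle (F i) s := by
  simp [onCircle]

theorem continuous_onCircle : Continuous (onCircle H) := by
  unfold onCircle; fun_prop

theorem onCircle_neg_arg : onCircle H (-s) = onCircle H s := by
  simp [onCircle]

theorem onCircle_periodic : Function.Periodic (onCircle H) (2 * Real.pi) := fun s => by
  simp [onCircle]

theorem abs_onCircle_le : |onCircle H s| ≤ ‖H‖ := H.norm_coe_le_norm _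

end onCircle

/-- An even `2π`-periodic function is determined by its values at the points `arccos ξ`. -/
theorem eq_apply_arccos_cos {f : ℝ → ℝ} (he : ∀ t, f (-t) = f t)
    (hp : Function.Periodic f (2 * Real.pi)) (s : ℝ) :
    f (Real.arccos (Real.cos s)) = f s := by
  have h : Real.cos (Real.arccos (Real.cos s)) = Real.cos s :=
    Real.cos_arccos (Real.neg_one_le_cos s) (Real.cos_le_one s)
  generalize Real.arccos (Real.cos s) = θ at h
  obtain ⟨k, hk | hk⟩ := Real.cos_eq_cos_iff.1 h
  · rw [hk, show 2 * (k : ℝ) * Real.pi + θ = θ + k * (2 * Real.pi) by ring, (hp.int_mul k) _]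
  · rw [hk, show 2 * (k : ℝ) * Real.pi - θ = -θ + k * (2 * Real.pi) by ring, (hp.int_mul k) _, he]

theorem intervalIntegrable_mul_onCircle {g : ℝ → ℝ} (hg : Continuous g) (H : CosSpace) (a b : ℝ) :
    IntervalIntegrable (fun t => g t * onCircle H t) MeasureTheory.volume a b :=
  (hg.mul (continuous_onCircle H)).intervalIntegrable _ _

/-! ### The resonant Fourier coefficient -/

/-- The Fourier coefficient at `cos`. -/
noncomputable def cosCoeff : CosSpace →L[ℝ] ℝ :=
  LinearMap.mkContinuous
    { toFun := fun H => 1 / Real.pi * ∫ t in (0 : ℝ)..(2 * Real.pi), Real.cos t * onCircle H t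
      map_add' := fun H H' => by
        simp only [onCircle_add, mul_add]
        rw [intervalIntegral.integral_add
          (intervalIntegrable_mul_onCircle Real.continuous_cos H _ _)
          (intervalIntegrable_mul_onCircle Real.continuous_cos H' _ _), mul_add]
      map_smul' := fun r H => by
        simp only [onCircle_smul, mul_left_comm _ r, intervalIntegral.integral_const_mul,
          RingHom.id_apply, smul_eq_mul] }
    2 fun H => by
      have h := abs_integral_mul_le Real.abs_cos_le_one (abs_onCircle_le H) (2 * Real.pi)
      have hpi := Real.pi_pos
      rw [abs_of_pos (by positivity : 0 < 2 * Real.pi)] at h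
      simp only [LinearMap.coe_mk, AddHom.coe_mk, Real.norm_eq_abs, abs_mul]
      rw [abs_of_pos (by positivity : 0 < 1 / Real.pi)]
      calc _ ≤ 1 / Real.pi * (‖H‖ * (2 * Real.pi)) := by gcongr
        _ = 2 * ‖H‖ := by field_simp

theorem cosCoeff_apply (H : CosSpace) : cosCoeff H =
    1 / Real.pi * ∫ t in (0 : ℝ)..(2 * Real.pi), Real.cos t * onCircle H t := rfl

theorem integral_cos_pow_period (n : ℕ) :
    (∫ t in (0 : ℝ)..(2 * Real.pi), Real.cos t ^ (n + 2)) =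
      (n + 1) / (n + 2) * ∫ t in (0 : ℝ)..(2 * Real.pi), Real.cos t ^ n := by
  rw [integral_cos_pow]
  simp

theorem cosCoeff_cosVar_pow (n : ℕ) : cosCoeff (cosVar ^ n) =
    1 / Real.pi * ∫ t in (0 : ℝ)..(2 * Real.pi), Real.cos t ^ (n + 1) := by
  simp only [cosCoeff_apply, onCircle_pow, onCircle_cosVar, pow_succ']

theorem cosCoeff_cosVar_pow_add_two (n : ℕ) : cosCoeff (cosVar ^ (n + 2)) =
    (n + 2) / (n + 3) * cosCoeff (cosVar ^ n) := by
  rw [cosCoeff_cosVar_pow, cosCoeff_cosVar_pow, show n + 2 + 1 = (n + 1) + 2 by ring,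
    integral_cos_pow_period]
  push_cast
  ring

theorem cosCoeff_one : cosCoeff 1 = 0 := by
  simpa using cosCoeff_cosVar_pow 0

theorem cosCoeff_cosVar : cosCoeff cosVar = 1 := by
  have h := cosCoeff_cosVar_pow 1
  rw [integral_cos_pow_period, pow_one] at h
  rw [h]
  have := Real.pi_ne_zero
  simp

theorem cosCoeff_cosVar_pow_two : cosCoeff (cosVar ^ 2) = 0 := by
  have := cosCoeff_cosVar_pow_add_two 0
  simpa [cosCoeff_one] using this

theorem cosCoeff_cosVar_pow_three : cosCoeff (cosVar ^ 3) = 3 / 4 := by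
  have := cosCoeff_cosVar_pow_add_two 1
  rw [pow_one, cosCoeff_cosVar] at this
  norm_num at this
  exact this

theorem cosCoeff_cosVar_pow_four : cosCoeff (cosVar ^ 4) = 0 := by
  rw [cosCoeff_cosVar_pow_add_two 2, cosCoeff_cosVar_pow_two, mul_zero]

/-! ### The solution operator on even periodic functions -/

theorem duhamel_onCircle_add (H H' : CosSpace) (s : ℝ) : duhamel (onCircle (H + H')) s =
    duhamel (onCircle H) s + duhamel (onCircle H') s := by
  simp only [duhamel, onCircle_add, mul_add]
  rw [intervalIntegral.integral_add (intervalIntegrable_mul_onCircle Real.continuous_cos H _ _)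
    (intervalIntegrable_mul_onCircle Real.continuous_cos H' _ _),
    intervalIntegral.integral_add (intervalIntegrable_mul_onCircle Real.continuous_sin H _ _)
    (intervalIntegrable_mul_onCircle Real.continuous_sin H' _ _)]
  ring

theorem duhamel_onCircle_smul (r : ℝ) (H : CosSpace) (s : ℝ) : duhamel (onCircle (r • H)) s =
    r * duhamel (onCircle H) s := by
  simp only [duhamel, onCircle_smul, mul_left_comm _ r, intervalIntegral.integral_const_mul]
  ring

/-- The operator `duhamel`, restricted to half a period. -/
noncomputable def duhamelCLM : CosSpace →L[ℝ] CosSpace :=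
  LinearMap.mkContinuous
    { toFun := fun H => ⟨fun ξ => duhamel (onCircle H) (Real.arccos ξ),
        (continuous_duhamel (continuous_onCircle H)).comp
          (Real.continuous_arccos.comp continuous_subtype_val)⟩
      map_add' := fun H H' => by
        ext ξ
        exact duhamel_onCircle_add H H' _
      map_smul' := fun r H => by
        ext ξ
        exact duhamel_onCircle_smul r H _ }
    (2 * Real.pi) fun H => by
      refine (ContinuousMap.norm_le _ (by positivity)).2 fun ξ => ?_
      refine (abs_duhamel_le (abs_onCircle_le H) _).trans ?_
      rw [abs_of_nonneg (Real.arccos_nonneg _)]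
      have := Real.arccos_le_pi (ξ : ℝ)
      nlinarith [norm_nonneg H]

theorem duhamel_onCircle_periodic {H : CosSpace} (hH : cosCoeff H = 0) :
    Function.Periodic (duhamel (onCircle H)) (2 * Real.pi) := by
  refine duhamel_periodic (continuous_onCircle H) (onCircle_neg_arg H) (onCircle_periodic H) ?_
  have hpi := Real.pi_ne_zero
  rw [cosCoeff_apply] at hH
  simpa [hpi] using hH

/-- The operator is defined on all of `CosSpace` by its values on [0, π], so no projection is
needed. Without resonance its even periodic extension is the true Duhamel integral. -/
theorem onCircle_duhamelCLM {H : CosSpace} (hH : cosCoeff H = 0) (s : ℝ) :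
    onCircle (duhamelCLM H) s = duhamel (onCircle H) s :=
  eq_apply_arccos_cos (duhamel_neg (onCircle_neg_arg H)) (duhamel_onCircle_periodic hH) s

theorem cosSpace_ext {H H' : CosSpace} (h : ∀ s, onCircle H s = onCircle H' s) : H = H' := by
  ext ξ
  have := h (Real.arccos ξ)
  simpa only [onCircle, Real.cos_arccos ξ.2.1 ξ.2.2] using this

/-- `duhamelCLM` inverts `f ↦ f'' + f` up to the value at `0`. -/
theorem duhamelCLM_eq_of_hasDerivAt {F H : CosSpace} (hH : cosCoeff H = 0) {f' f'' : ℝ → ℝ}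
    (h1 : ∀ t, HasDerivAt (onCircle F) (f' t) t) (h2 : ∀ t, HasDerivAt f' (f'' t) t)
    (hf : Continuous f'') (h0 : f' 0 = 0) (h : ∀ t, f'' t + onCircle F t = onCircle H t) :
    duhamelCLM H = F - onCircle F 0 • cosVar := by
  refine cosSpace_ext fun s => ?_
  rw [onCircle_duhamelCLM hH, ← funext h, duhamel_eq_of_hasDerivAt h1 h2 hf, h0]
  simp

/-! ### Exact zeros near approximate zeros -/

/-- A quantitative implicit function theorem: near an approximate zero curve `x` of `G` there are
exact zeros, at a distance of the order of the residual. -/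
theorem exists_zero_near_approximate_zero {E F : Type*} [NormedAddCommGroup E] [NormedSpace ℝ E]
    [CompleteSpace E] [NormedAddCommGroup F] [NormedSpace ℝ F] [CompleteSpace F]
    {G : ℝ × E → F} (hG : ContDiffAt ℝ 1 G 0) (hsurj : ∀ y, ∃ x, fderiv ℝ G 0 (0, x) = y)
    {x : ℝ → E} {K₁ K₂ : ℝ} (hK₁ : 0 ≤ K₁) (hK₂ : 0 ≤ K₂)
    (hx : ∀ a ∈ Set.Ioo (0 : ℝ) 1, ‖x a‖ ≤ K₁ * a)
    (hres : ∀ a ∈ Set.Ioo (0 : ℝ) 1, ‖G (a, x a)‖ ≤ K₂ * a ^ 3) :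
    ∃ a₀ > (0 : ℝ), a₀ ≤ 1 ∧ ∃ K ≥ (0 : ℝ), ∀ a ∈ Set.Ioo 0 a₀,
      ∃ y, G (a, y) = 0 ∧ ‖y - x a‖ ≤ K * a ^ 3 := by
  set T : E →L[ℝ] F := (fderiv ℝ G 0).comp (ContinuousLinearMap.inr ℝ ℝ E) with hT
  have hTs : T.range = ⊤ := by
    refine LinearMap.range_eq_top.2 fun y => ?_
    obtain ⟨z, hz⟩ := hsurj y
    exact ⟨z, by simpa [hT] using hz⟩
  set N := T.nonlinearRightInverseOfSurjective hTs with hN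
  have hn : 0 < N.nnnorm := T.nonlinearRightInverseOfSurjective_nnnorm_pos hTs
  have hn' : (0 : ℝ) < N.nnnorm := hn
  obtain ⟨s, hs, happ⟩ := (hG.hasStrictFDerivAt (by norm_num)).approximates_deriv_on_nhds
    (c := N.nnnorm⁻¹ / 2) (Or.inr (by positivity))
  obtain ⟨r, hr, hrs⟩ := Metric.mem_nhds_iff.1 hs
  -- With linearisation error at most half of N⁻¹, the image of a ball of radius ρ about `x a`
  -- covers radius ρ/(2N). This `K` makes that equal to the residual bound for ρ = K·a³.
  set K : ℝ := 2 * N.nnnorm * K₂ with hK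
  have hK0 : 0 ≤ K := by positivity
  refine ⟨min 1 (r / (K₁ + K + 1)), by positivity, min_le_left _ _, K, hK0, fun a ha => ?_⟩
  have ha0 : 0 < a := ha.1
  have ha1 : a < 1 := ha.2.trans_le (min_le_left _ _)
  have har : a * (K₁ + K + 1) < r := (lt_div_iff₀ (by positivity)).1
    (ha.2.trans_le (min_le_right _ _))
  have ha3 : a ^ 3 ≤ a := by
    simpa using pow_le_pow_of_le_one ha0.le ha1.le (show 1 ≤ 3 by norm_num)
  have hslice : ApproximatesLinearOn (fun y => G (a, y)) T (Metric.closedBall (x a) (K * a ^ 3))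
      (N.nnnorm⁻¹ / 2) := by
    have hmem : ∀ y ∈ Metric.closedBall (x a) (K * a ^ 3), (a, y) ∈ s := fun y hy => by
      refine hrs ?_
      rw [mem_ball_zero_iff, Prod.norm_def, max_lt_iff]
      have h1 : ‖y‖ ≤ ‖x a‖ + K * a ^ 3 := by
        have := norm_le_norm_add_norm_sub' y (x a)
        have h2 : ‖y - x a‖ ≤ K * a ^ 3 := by rwa [← dist_eq_norm]
        linarith
      have h3 := hx a ⟨ha0, ha1⟩
      have h4 : K * a ^ 3 ≤ K * a := by gcongr
      constructor
      · rw [Real.norm_eq_abs, abs_of_pos ha0]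
        nlinarith
      · nlinarith
    intro y hy z hz
    have := happ (a, y) (hmem y hy) (a, z) (hmem z hz)
    simpa [hT, Prod.norm_def] using this
  have hsub := hslice.surjOn_closedBall_of_nonlinearRightInverse N
    (show 0 ≤ K * a ^ 3 by positivity) subset_rfl
  have hzero : (0 : F) ∈ Metric.closedBall (G (a, x a))
      (((N.nnnorm : ℝ)⁻¹ - (N.nnnorm⁻¹ / 2 : NNReal)) * (K * a ^ 3)) := by
    rw [mem_closedBall_iff_norm, zero_sub, norm_neg]
    refine (hres a ⟨ha0, ha1⟩).trans_eq ?_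
    rw [hK]
    push_cast
    field_simp
    ring
  obtain ⟨y, hy, hGy⟩ := hsub hzero
  exact ⟨y, hGy, by rwa [← dist_eq_norm]⟩

/-! ### Expansion of the nonlinearity -/

/-- The part of second and higher order of the power `(m + a v) ^ (p + 1)`, divided by `a ^ 2`. -/
noncomputable def powerTail (p : ℕ) (m a : ℝ) (v : CosSpace) : CosSpace :=
  ∑ k ∈ Finset.range (p + 3), (((p + 1).choose (k + 2) : ℝ) * m ^ (p - 1 - k) * a ^ k) • v ^ (k + 2)

/-- The last three indices of `powerTail` have zero binomial coefficient, which also makes the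
truncated exponents harmless. They allow `powerTail_eq` to split off three terms for every `p`. -/
theorem pow_eq_add_powerTail {p : ℕ} (m a : ℝ) (v : CosSpace) (s : ℝ) :
    (m + a * onCircle v s) ^ (p + 1) =
      m ^ (p + 1) + (p + 1) * m ^ p * (a * onCircle v s) +
        a ^ 2 * onCircle (powerTail p m a v) s := by
  have h0 : ∀ j, (p + 1).choose (p + j + 2) = 0 := fun j => Nat.choose_eq_zero_of_lt (by omega)
  have h1 := h0 0
  have h2 := h0 1
  have h3 := h0 2
  rw [add_comm m, add_pow, Finset.sum_range_succ', Finset.sum_range_succ', powerTail, onCircle_sum,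
    Finset.sum_range_succ, Finset.sum_range_succ, Finset.sum_range_succ]
  simp only [add_zero] at h1
  simp only [onCircle_smul, onCircle_pow, h1, h2, h3, Nat.cast_zero, zero_mul, add_zero,
    Finset.mul_sum, zero_add, pow_one, pow_zero, Nat.choose_one_right, Nat.choose_zero_right,
    Nat.cast_one, Nat.add_sub_cancel, Nat.sub_zero, mul_one, one_mul]
  have : ∀ k ∈ Finset.range p, (a * onCircle v s) ^ (k + 1 + 1) * m ^ (p + 1 - (k + 1 + 1)) *
      ((p + 1).choose (k + 1 + 1) : ℝ) =
      a ^ 2 * (((p + 1).choose (k + 2) : ℝ) * m ^ (p - 1 - k) * a ^ k * onCircle v s ^ (k + 2)) := by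
    intro k _
    rw [show p + 1 - (k + 1 + 1) = p - 1 - k by omega, mul_pow]
    ring
  rw [Finset.sum_congr rfl this]
  push_cast
  ring

/-- The coefficient of the power `v ^ j` in `(m + v) ^ (p + 1)`. -/
noncomputable def binomCoeff (p : ℕ) (m : ℝ) (j : ℕ) : ℝ :=
  ((p + 1).choose j : ℝ) * m ^ (p + 1 - j)

/-- The terms of `powerTail` from the fifth power on, divided by `a ^ 3`. -/
noncomputable def powerTailFive (p : ℕ) (m a : ℝ) (v : CosSpace) : CosSpace :=
  ∑ k ∈ Finset.range p,
    (((p + 1).choose (k + 5) : ℝ) * m ^ (p - 1 - (k + 3)) * a ^ k) • v ^ (k + 5)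

theorem powerTail_eq (p : ℕ) (m a : ℝ) (v : CosSpace) : powerTail p m a v =
    binomCoeff p m 2 • v ^ 2 + a • binomCoeff p m 3 • v ^ 3 + a ^ 2 • binomCoeff p m 4 • v ^ 4 +
      a ^ 3 • powerTailFive p m a v := by
  rw [powerTail, Finset.sum_range_succ', Finset.sum_range_succ', Finset.sum_range_succ',
    powerTailFive, Finset.smul_sum]
  have : ∀ k ∈ Finset.range p, (((p + 1).choose (k + 1 + 1 + 1 + 2) : ℝ) *
      m ^ (p - 1 - (k + 1 + 1 + 1)) * a ^ (k + 1 + 1 + 1)) • v ^ (k + 1 + 1 + 1 + 2) =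
      a ^ 3 • (((p + 1).choose (k + 5) : ℝ) * m ^ (p - 1 - (k + 3)) * a ^ k) • v ^ (k + 5) := by
    intro k _
    rw [smul_smul]
    congr 1
    ring
  rw [Finset.sum_congr rfl this]
  simp only [binomCoeff, smul_smul]
  rw [show p + 1 - 2 = p - 1 - 0 by omega, show p + 1 - 3 = p - 1 - 1 by omega,
    show p + 1 - 4 = p - 1 - 2 by omega]
  norm_num
  module

/-! ### The approximate wave and the zero problem -/

/-- The second-order constant in the expansion of the wave. -/
noncomputable def meanCoeff (p : ℕ) (m c₂ : ℝ) : ℝ := c₂ * m / 2 - binomCoeff p m 2 / 4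

/-- The coefficient of the second harmonic in the expansion of the wave. -/
noncomputable def secondCoeff (p : ℕ) (m : ℝ) : ℝ := binomCoeff p m 2 / 12

/-- The coefficient of the third harmonic in the expansion of the wave. -/
noncomputable def thirdCoeff (p : ℕ) (m : ℝ) : ℝ :=
  (binomCoeff p m 2 * secondCoeff p m + binomCoeff p m 3 / 4) / 16

/-- The second-order profile `A + B cos 2s`. -/
noncomputable def profileTwo (p : ℕ) (m c₂ : ℝ) : CosSpace :=
  meanCoeff p m c₂ • 1 + secondCoeff p m • ((2 : ℝ) • cosVar ^ 2 - 1)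

/-- The third-order profile `C cos 3s`. -/
noncomputable def profileThree (p : ℕ) (m : ℝ) : CosSpace :=
  thirdCoeff p m • ((4 : ℝ) • cosVar ^ 3 - (3 : ℝ) • cosVar)

/-- The approximation `a (A + B cos 2s) + a² C cos 3s` of the profile correction. -/
noncomputable def approxProfile (p : ℕ) (m c₂ a : ℝ) : CosSpace :=
  a • profileTwo p m c₂ + a ^ 2 • profileThree p m

/-- The image of `approxProfile` under `f ↦ f'' + f`. -/
noncomputable def approxSource (p : ℕ) (m c₂ a : ℝ) : CosSpace :=
  a • (meanCoeff p m c₂ • 1 - (3 * secondCoeff p m) • ((2 : ℝ) • cosVar ^ 2 - 1)) -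
    (8 * a ^ 2) • profileThree p m

/-- The part of the source term that carries an additional factor `a`. -/
noncomputable def waveForcing (p : ℕ) (m : ℝ) (q : ℝ × (CosSpace × ℝ)) : CosSpace :=
  q.2.2 • (cosVar + q.2.1) - powerTail p m q.1 (cosVar + q.2.1)

/-- The source term: the wave equation reads `w'' + w = waveSource p m (a, w, δ)`. -/
noncomputable def waveSource (p : ℕ) (m : ℝ) (q : ℝ × (CosSpace × ℝ)) : CosSpace :=
  (1 / 2 : ℝ) • ((q.2.2 * m) • 1 + q.1 • waveForcing p m q)

/-- The map whose zeros `(a, w, δ)` are the waves. -/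
noncomputable def waveMap (p : ℕ) (m c₂ : ℝ) (q : ℝ × (CosSpace × ℝ)) : CosSpace × ℝ :=
  (q.2.1 - onCircle (approxProfile p m c₂ q.1) 0 • cosVar - duhamelCLM (waveSource p m q),
    cosCoeff (waveForcing p m q))

theorem onCircle_approxProfile (p : ℕ) (m c₂ a s : ℝ) : onCircle (approxProfile p m c₂ a) s =
    a * (meanCoeff p m c₂ + secondCoeff p m * Real.cos (2 * s)) +
      a ^ 2 * (thirdCoeff p m * Real.cos (3 * s)) := by
  rw [Real.cos_two_mul, Real.cos_three_mul]
  simp [approxProfile, profileTwo, profileThree]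
  ring

theorem onCircle_approxSource (p : ℕ) (m c₂ a s : ℝ) : onCircle (approxSource p m c₂ a) s =
    a * (meanCoeff p m c₂ - 3 * secondCoeff p m * Real.cos (2 * s)) -
      8 * a ^ 2 * (thirdCoeff p m * Real.cos (3 * s)) := by
  rw [Real.cos_two_mul, Real.cos_three_mul]
  simp [approxSource, profileThree]

theorem cosCoeff_approxSource (p : ℕ) (m c₂ a : ℝ) : cosCoeff (approxSource p m c₂ a) = 0 := by
  simp only [approxSource, profileThree, map_sub, map_smul, smul_eq_mul, cosCoeff_one,
    cosCoeff_cosVar, cosCoeff_cosVar_pow_two, cosCoeff_cosVar_pow_three]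
  norm_num

theorem duhamelCLM_approxSource (p : ℕ) (m c₂ a : ℝ) : duhamelCLM (approxSource p m c₂ a) =
    approxProfile p m c₂ a - onCircle (approxProfile p m c₂ a) 0 • cosVar := by
  refine duhamelCLM_eq_of_hasDerivAt (cosCoeff_approxSource p m c₂ a)
    (f' := fun s => a * (secondCoeff p m * (-(2 * Real.sin (2 * s)))) +
      a ^ 2 * (thirdCoeff p m * (-(3 * Real.sin (3 * s)))))
    (f'' := fun s => a * (secondCoeff p m * (-(2 * (2 * Real.cos (2 * s))))) +
      a ^ 2 * (thirdCoeff p m * (-(3 * (3 * Real.cos (3 * s)))))) ?_ ?_ (by fun_prop) (by simp) ?_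
  · intro t
    rw [funext (onCircle_approxProfile p m c₂ a)]
    have h2 := ((hasDerivAt_id t).const_mul 2).cos
    have h3 := ((hasDerivAt_id t).const_mul 3).cos
    refine ((((h2.const_mul (secondCoeff p m)).const_add (meanCoeff p m c₂)).const_mul a).add
      ((h3.const_mul (thirdCoeff p m)).const_mul (a ^ 2))).congr_deriv ?_
    simp only [id]
    ring
  · intro t
    have h2 := ((hasDerivAt_id t).const_mul 2).sin
    have h3 := ((hasDerivAt_id t).const_mul 3).sin
    refine (((((h2.const_mul 2).neg).const_mul (secondCoeff p m)).const_mul a).add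
      ((((h3.const_mul 3).neg).const_mul (thirdCoeff p m)).const_mul (a ^ 2))).congr_deriv ?_
    simp only [id]
    ring
  · intro t
    rw [onCircle_approxProfile, onCircle_approxSource]
    ring

theorem duhamelCLM_one : duhamelCLM 1 = 1 - cosVar := by
  have := duhamelCLM_eq_of_hasDerivAt (F := 1) (H := 1) cosCoeff_one (f' := fun _ => 0)
    (f'' := fun _ => 0) (fun t => hasDerivAt_const t 1) (fun t => hasDerivAt_const t 0)
    continuous_const rfl (fun t => by simp)
  simpa using this

/-! ### The residual of the approximate wave -/

section expansion

variable (p : ℕ) (m c₂ : ℝ)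

/-- The second-order coefficient in `a` of `waveForcing` along the approximate solution. -/
noncomputable def forcingTwo : CosSpace :=
  c₂ • profileTwo p m c₂ -
    binomCoeff p m 2 • (profileTwo p m c₂ ^ 2 + (2 : ℝ) • (cosVar * profileThree p m)) -
    (3 * binomCoeff p m 3) • (cosVar ^ 2 * profileTwo p m c₂) - binomCoeff p m 4 • cosVar ^ 4

/-- The third-order remainder of `waveForcing` along the approximate solution. -/
noncomputable def forcingThree (a : ℝ) : CosSpace :=
  let w₁ := profileTwo p m c₂
  let w₂ := profileThree p m
  let y := w₁ + a • w₂
  c₂ • w₂ - binomCoeff p m 2 • ((2 : ℝ) • (w₁ * w₂) + a • w₂ ^ 2) -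
    binomCoeff p m 3 • ((3 : ℝ) • (cosVar ^ 2 * w₂) + (3 : ℝ) • (cosVar * y ^ 2) + a • y ^ 3) -
    binomCoeff p m 4 • ((4 : ℝ) • (cosVar ^ 3 * y) + (6 * a) • (cosVar ^ 2 * y ^ 2) +
      (4 * a ^ 2) • (cosVar * y ^ 3) + a ^ 3 • y ^ 4) -
    powerTailFive p m a (cosVar + a • y)

theorem waveForcing_approx (a : ℝ) :
    waveForcing p m (a, approxProfile p m c₂ a, c₂ * a) =
      -(binomCoeff p m 2 • cosVar ^ 2) +
      a • (c₂ • cosVar - (2 * binomCoeff p m 2) • (cosVar * profileTwo p m c₂) -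
        binomCoeff p m 3 • cosVar ^ 3) +
      a ^ 2 • forcingTwo p m c₂ + a ^ 3 • forcingThree p m c₂ a := by
  have hv : approxProfile p m c₂ a = a • (profileTwo p m c₂ + a • profileThree p m) := by
    rw [approxProfile, smul_add, smul_smul, pow_two]
  simp only [waveForcing, powerTail_eq, hv, forcingTwo, forcingThree]
  generalize profileTwo p m c₂ = w₁
  generalize profileThree p m = w₂
  generalize powerTailFive p m a (cosVar + a • (w₁ + a • w₂)) = R
  ext ξ
  simp
  ring

variable {p m c₂}

/-- A, B, C are chosen to match the constant and second harmonic at order a and the third harmonic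
at order a². The condition `hc` removes the resonant first harmonic at order a². It is linear in c₂,
which also enters through A. -/
theorem waveSource_approx
    (hc : c₂ = 2 * binomCoeff p m 2 * (meanCoeff p m c₂ + secondCoeff p m / 2) +
      3 / 4 * binomCoeff p m 3) (a : ℝ) :
    waveSource p m (a, approxProfile p m c₂ a, c₂ * a) = approxSource p m c₂ a +
      a ^ 3 • ((1 / 2 : ℝ) • (forcingTwo p m c₂ + a • forcingThree p m c₂ a)) := by
  simp only [waveSource, waveForcing_approx, approxSource]
  generalize forcingTwo p m c₂ = w₁
  generalize forcingThree p m c₂ a = w₂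
  have hA : meanCoeff p m c₂ = c₂ * m / 2 - binomCoeff p m 2 / 4 := rfl
  have hB : secondCoeff p m = binomCoeff p m 2 / 12 := rfl
  have hC : thirdCoeff p m =
    (binomCoeff p m 2 * secondCoeff p m + binomCoeff p m 3 / 4) / 16 := rfl
  ext ξ
  simp [profileTwo, profileThree]
  generalize cosVar ξ = x
  rw [hC]
  linear_combination (-a) * hA - 3 * a * hB * (1 - 2 * x ^ 2) + a ^ 2 / 2 * x * hc

/-- Order a vanishes by `hc`. Orders 1 and a² vanish by parity: they are even polynomials in cos,
hence have no first harmonic. -/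
theorem cosCoeff_waveForcing_approx
    (hc : c₂ = 2 * binomCoeff p m 2 * (meanCoeff p m c₂ + secondCoeff p m / 2) +
      3 / 4 * binomCoeff p m 3) (a : ℝ) :
    cosCoeff (waveForcing p m (a, approxProfile p m c₂ a, c₂ * a)) =
      a ^ 3 * cosCoeff (forcingThree p m c₂ a) := by
  have h1 : cosVar * profileTwo p m c₂ =
      (meanCoeff p m c₂ - secondCoeff p m) • cosVar + (2 * secondCoeff p m) • cosVar ^ 3 := by
    ext ξ
    simp [profileTwo]
    ring
  have h2 : ∃ r₀ r₁ r₂ : ℝ, forcingTwo p m c₂ =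
      r₀ • 1 + r₁ • cosVar ^ 2 + r₂ • cosVar ^ 4 := by
    set A := meanCoeff p m c₂ with hA
    set B := secondCoeff p m with hB
    set C := thirdCoeff p m with hC
    refine ⟨c₂ * (A - B) - binomCoeff p m 2 * (A - B) ^ 2,
      c₂ * (2 * B) - binomCoeff p m 2 * (4 * (A - B) * B - 6 * C) -
        3 * binomCoeff p m 3 * (A - B),
      -(binomCoeff p m 2 * (4 * B ^ 2 + 8 * C)) - 3 * binomCoeff p m 3 * (2 * B) -
        binomCoeff p m 4, ?_⟩
    ext ξ
    simp [forcingTwo, profileTwo, profileThree, ← hA, ← hB, ← hC]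
    ring
  obtain ⟨r₀, r₁, r₂, h2⟩ := h2
  rw [waveForcing_approx, h1, h2]
  simp only [map_sub, map_add, map_neg, map_smul, cosCoeff_one, cosCoeff_cosVar,
    cosCoeff_cosVar_pow_two, cosCoeff_cosVar_pow_three, cosCoeff_cosVar_pow_four, smul_eq_mul]
  linear_combination a * hc

end expansion

/-! ### Smoothness and linearisation of the zero problem -/

theorem contDiff_powerTail (p : ℕ) (m : ℝ) {E : Type*} [NormedAddCommGroup E] [NormedSpace ℝ E]
    {f : E → ℝ} {v : E → CosSpace} (hf : ContDiff ℝ 1 f) (hv : ContDiff ℝ 1 v) :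
    ContDiff ℝ 1 fun x => powerTail p m (f x) (v x) := by
  unfold powerTail
  exact ContDiff.sum fun k _ => (contDiff_const.mul (hf.pow k)).smul (hv.pow _)

theorem contDiff_waveForcing (p : ℕ) (m : ℝ) : ContDiff ℝ 1 (waveForcing p m) := by
  have hv : ContDiff ℝ 1 fun q : ℝ × (CosSpace × ℝ) => cosVar + q.2.1 := by fun_prop
  exact (contDiff_snd.snd.smul hv).sub (contDiff_powerTail p m contDiff_fst hv)

theorem contDiff_waveSource (p : ℕ) (m : ℝ) : ContDiff ℝ 1 (waveSource p m) := by
  have := contDiff_waveForcing p m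
  unfold waveSource
  fun_prop

theorem contDiff_waveMap (p : ℕ) (m c₂ : ℝ) : ContDiff ℝ 1 (waveMap p m c₂) := by
  have h1 := contDiff_waveForcing p m
  have h2 := contDiff_waveSource p m
  have h3 : ContDiff ℝ 1 fun q : ℝ × (CosSpace × ℝ) =>
      onCircle (approxProfile p m c₂ q.1) 0 := by
    simp only [onCircle_approxProfile]
    fun_prop
  unfold waveMap
  exact ((contDiff_snd.fst.sub (h3.smul contDiff_const)).sub (duhamelCLM.contDiff.comp h2)).prodMk
    (cosCoeff.contDiff.comp h1)

theorem continuous_forcingThree (p : ℕ) (m c₂ : ℝ) : Continuous (forcingThree p m c₂) := by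
  unfold forcingThree powerTailFive
  fun_prop

/-- On rays with a = 0 the map is a polynomial in t, so its derivative at the origin can be read off
the linear term. -/
theorem waveMap_zero_smul (p : ℕ) (m c₂ t δ : ℝ) (w : CosSpace) :
    waveMap p m c₂ (t • (0, w, δ)) =
      (t • (w - (δ * m / 2) • (1 - cosVar)),
        t * (δ - 2 * binomCoeff p m 2 * cosCoeff (cosVar * w)) +
          t ^ 2 * (δ * cosCoeff w - binomCoeff p m 2 * cosCoeff (w ^ 2))) := by
  have hF : waveForcing p m (t • (0, w, δ)) = t • δ • cosVar + t ^ 2 • δ • w -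
      binomCoeff p m 2 • (cosVar ^ 2 + (2 * t) • (cosVar * w) + t ^ 2 • w ^ 2) := by
    simp only [waveForcing, powerTail_eq]
    ext ξ
    simp
    ring
  have hS : waveSource p m (t • (0, w, δ)) = (t * (δ * m / 2)) • 1 := by
    simp only [waveSource]
    ext ξ
    simp
    ring
  rw [waveMap, hF, hS, map_smul, duhamelCLM_one]
  refine Prod.ext ?_ ?_
  · ext ξ
    simp [onCircle_approxProfile]
    ring
  · simp only [map_sub, map_add, map_smul, cosCoeff_cosVar, cosCoeff_cosVar_pow_two, smul_eq_mul]
    ring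

theorem fderiv_waveMap_apply (p : ℕ) (m c₂ δ : ℝ) (w : CosSpace) :
    fderiv ℝ (waveMap p m c₂) 0 (0, w, δ) =
      (w - (δ * m / 2) • (1 - cosVar), δ - 2 * binomCoeff p m 2 * cosCoeff (cosVar * w)) := by
  have h0 : HasFDerivAt (waveMap p m c₂) (fderiv ℝ (waveMap p m c₂) 0)
      ((0 : ℝ) • ((0, w, δ) : ℝ × (CosSpace × ℝ))) := by
    rw [zero_smul]
    exact ((contDiff_waveMap p m c₂).differentiable (by norm_num) 0).hasFDerivAt
  have h1 := h0.comp_hasDerivAt (0 : ℝ)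
    ((hasDerivAt_id (0 : ℝ)).smul_const ((0, w, δ) : ℝ × (CosSpace × ℝ)))
  have h2 : HasDerivAt (fun t : ℝ => waveMap p m c₂ (t • (0, w, δ)))
      (w - (δ * m / 2) • (1 - cosVar), δ - 2 * binomCoeff p m 2 * cosCoeff (cosVar * w)) 0 := by
    simp only [waveMap_zero_smul]
    refine HasDerivAt.prodMk ?_ ?_
    · simpa using (hasDerivAt_id (0 : ℝ)).smul_const (w - (δ * m / 2) • (1 - cosVar))
    · have := ((hasDerivAt_id (0 : ℝ)).mul_const
          (δ - 2 * binomCoeff p m 2 * cosCoeff (cosVar * w))).add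
        (((hasDerivAt_id (0 : ℝ)).pow 2).mul_const
          (δ * cosCoeff w - binomCoeff p m 2 * cosCoeff (w ^ 2)))
      refine HasDerivAt.congr_deriv (f := fun t : ℝ => _) this ?_
      simp
  have h3 := h1.unique h2
  simpa using h3

theorem fderiv_waveMap_surjective {p : ℕ} {m : ℝ} (hp : p ≠ 0) (hm : binomCoeff p m 2 * m = p + 1)
    (c₂ : ℝ) (y : CosSpace × ℝ) : ∃ x, fderiv ℝ (waveMap p m c₂) 0 (0, x) = y := by
  have hp' : (p : ℝ) ≠ 0 := by exact_mod_cast hp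
  -- Eliminating w from the first component leaves δ − δ·(binomCoeff p m 2)·m = −pδ in the second.
  set δ : ℝ := -(y.2 + 2 * binomCoeff p m 2 * cosCoeff (cosVar * y.1)) / p with hδ
  refine ⟨(y.1 + (δ * m / 2) • (1 - cosVar), δ), ?_⟩
  rw [fderiv_waveMap_apply]
  refine Prod.ext (by simp) ?_
  have : cosCoeff (cosVar * (y.1 + (δ * m / 2) • (1 - cosVar))) =
      cosCoeff (cosVar * y.1) + δ * m / 2 := by
    rw [mul_add, mul_smul_comm, mul_sub, mul_one, ← pow_two]
    simp [cosCoeff_cosVar, cosCoeff_cosVar_pow_two]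
  rw [this]
  have h4 : δ * p = -(y.2 + 2 * binomCoeff p m 2 * cosCoeff (cosVar * y.1)) := by
    rw [hδ]; field_simp
  simp only
  linear_combination -h4 - δ * hm

/-! ### Solving the zero problem -/

theorem exists_wave_profile {p : ℕ} {m c₂ : ℝ} (hp : p ≠ 0) (hm : binomCoeff p m 2 * m = p + 1)
    (hc : c₂ = 2 * binomCoeff p m 2 * (meanCoeff p m c₂ + secondCoeff p m / 2) +
      3 / 4 * binomCoeff p m 3) :
    ∃ a₀ > (0 : ℝ), a₀ ≤ 1 ∧ ∃ K ≥ (0 : ℝ), ∀ a ∈ Set.Ioo 0 a₀, ∃ (w : CosSpace) (δ : ℝ),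
      waveMap p m c₂ (a, w, δ) = 0 ∧ ‖w‖ ≤ K * a ∧ ‖w - approxProfile p m c₂ a‖ ≤ K * a ^ 3 ∧
      |δ - c₂ * a| ≤ K * a ^ 3 ∧
      ‖waveSource p m (a, w, δ) - approxSource p m c₂ a‖ ≤ K * a ^ 3 := by
  set x : ℝ → CosSpace × ℝ := fun a => (approxProfile p m c₂ a, c₂ * a) with hx
  set K₁ : ℝ := ‖profileTwo p m c₂‖ + ‖profileThree p m‖ + |c₂| with hK₁
  have hx1 : ∀ a ∈ Set.Ioo (0 : ℝ) 1, ‖x a‖ ≤ K₁ * a := fun a ha => by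
    have h1 : ‖approxProfile p m c₂ a‖ ≤
        a * ‖profileTwo p m c₂‖ + a ^ 2 * ‖profileThree p m‖ := by
      refine (norm_add_le _ _).trans_eq ?_
      rw [norm_smul, norm_smul, norm_pow, Real.norm_of_nonneg ha.1.le]
    have h2 : a ^ 2 ≤ a := by nlinarith [ha.1, ha.2]
    have h3 := mul_le_mul_of_nonneg_right h2 (norm_nonneg (profileThree p m))
    have h4 := mul_nonneg ha.1.le (abs_nonneg c₂)
    have h5 := mul_nonneg ha.1.le (norm_nonneg (profileTwo p m c₂))
    have h6 := mul_nonneg ha.1.le (norm_nonneg (profileThree p m))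
    rw [Prod.norm_def, max_le_iff]
    constructor
    · simp only [hx]
      linarith
    · simp only [hx, Real.norm_eq_abs, abs_mul, abs_of_pos ha.1]
      linarith
  obtain ⟨M, hM⟩ := isCompact_Icc.exists_bound_of_continuousOn
    (continuous_forcingThree p m c₂).continuousOn (s := Set.Icc (0 : ℝ) 1)
  have hM0 : 0 ≤ M := (norm_nonneg _).trans (hM 0 (by simp))
  set K₂ : ℝ := ‖forcingTwo p m c₂‖ + M with hK₂
  have hsrc : ∀ a ∈ Set.Ioo (0 : ℝ) 1,
      ‖waveSource p m (a, x a) - approxSource p m c₂ a‖ ≤ K₂ * a ^ 3 := fun a ha => by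
    rw [hx, waveSource_approx hc, add_sub_cancel_left, norm_smul, norm_smul, norm_pow,
      Real.norm_of_nonneg ha.1.le]
    have h1 : ‖forcingTwo p m c₂ + a • forcingThree p m c₂ a‖ ≤ K₂ := by
      refine (norm_add_le _ _).trans ?_
      rw [norm_smul, Real.norm_of_nonneg ha.1.le]
      have := hM a ⟨ha.1.le, ha.2.le⟩
      nlinarith [norm_nonneg (forcingThree p m c₂ a), ha.1, ha.2]
    have h3 : (0 : ℝ) ≤ a ^ 3 := pow_nonneg ha.1.le 3
    have h2 : ‖(1 / 2 : ℝ)‖ = 1 / 2 := by norm_num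
    rw [h2]
    nlinarith [norm_nonneg (forcingTwo p m c₂ + a • forcingThree p m c₂ a)]
  have hres : ∀ a ∈ Set.Ioo (0 : ℝ) 1, ‖waveMap p m c₂ (a, x a)‖ ≤
      (‖duhamelCLM‖ * K₂ + ‖cosCoeff‖ * M) * a ^ 3 := fun a ha => by
    have ha3 : (0 : ℝ) ≤ a ^ 3 := pow_nonneg ha.1.le 3
    have h1 : waveMap p m c₂ (a, x a) =
        (-duhamelCLM (waveSource p m (a, x a) - approxSource p m c₂ a),
          a ^ 3 * cosCoeff (forcingThree p m c₂ a)) := by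
      rw [map_sub, duhamelCLM_approxSource, ← cosCoeff_waveForcing_approx hc]
      refine Prod.ext ?_ rfl
      simp only [waveMap, hx]
      abel
    have h2 := (duhamelCLM.le_opNorm _).trans
      (mul_le_mul_of_nonneg_left (hsrc a ha) (norm_nonneg duhamelCLM))
    have h3 := (cosCoeff.le_opNorm _).trans
      (mul_le_mul_of_nonneg_left (hM a ⟨ha.1.le, ha.2.le⟩) (norm_nonneg cosCoeff))
    have h4 : 0 ≤ ‖duhamelCLM‖ * K₂ * a ^ 3 := by positivity
    have h5 : 0 ≤ ‖cosCoeff‖ * M * a ^ 3 := by positivity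
    rw [h1, Prod.norm_def, max_le_iff]
    constructor
    · rw [norm_neg]
      linarith
    · rw [norm_mul, Real.norm_of_nonneg ha3]
      nlinarith
  obtain ⟨a₁, ha₁, ha₁', K, hK, hzero⟩ := exists_zero_near_approximate_zero
    (contDiff_waveMap p m c₂).contDiffAt (fderiv_waveMap_surjective hp hm c₂)
    (by positivity) (by positivity) hx1 hres
  -- Lipschitz continuity carries the O(a³) closeness of the solutions over to their sources, as the
  -- derivative estimates require.
  obtain ⟨Λ, t, ht, hlip⟩ := (contDiff_waveSource p m).contDiffAt.exists_lipschitzOnWith (x := 0)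
  obtain ⟨r, hr, hrt⟩ := Metric.mem_nhds_iff.1 ht
  refine ⟨min a₁ (r / (K₁ + K + 1)), by positivity, (min_le_left _ _).trans ha₁',
    (K₁ + K) + Λ * K + K₂, by positivity, fun a ha => ?_⟩
  have ha0 : 0 < a := ha.1
  have haa : a ∈ Set.Ioo 0 a₁ := ⟨ha0, ha.2.trans_le (min_le_left _ _)⟩
  have ha1 : a ∈ Set.Ioo (0 : ℝ) 1 := ⟨ha0, haa.2.trans_le ha₁'⟩
  have har : a * (K₁ + K + 1) < r := (lt_div_iff₀ (by positivity)).1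
    (ha.2.trans_le (min_le_right _ _))
  have ha3 : a ^ 3 ≤ a := by
    simpa using pow_le_pow_of_le_one ha0.le ha1.2.le (show 1 ≤ 3 by norm_num)
  have ha3' : 0 < a ^ 3 := by positivity
  obtain ⟨y, hy, hyx⟩ := hzero a haa
  have hK₁0 : 0 ≤ K₁ := by positivity
  have hy1 : ‖y‖ ≤ (K₁ + K) * a := by
    have h1 := norm_le_norm_add_norm_sub' y (x a)
    have h2 := hx1 a ha1
    have h3 : K * a ^ 3 ≤ K * a := by gcongr
    linarith
  have hmem : ∀ z : CosSpace × ℝ, ‖z‖ ≤ (K₁ + K) * a → (a, z) ∈ t := fun z hz => by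
    refine hrt ?_
    rw [mem_ball_zero_iff, Prod.norm_def, max_lt_iff]
    constructor
    · rw [Real.norm_eq_abs, abs_of_pos ha0]
      nlinarith
    · nlinarith
  have hl := hlip.norm_sub_le (hmem y hy1)
    (hmem (x a) ((hx1 a ha1).trans (by nlinarith)))
  have hl' : ‖((a, y) - (a, x a) : ℝ × (CosSpace × ℝ))‖ = ‖y - x a‖ := by
    simp [Prod.norm_def]
  rw [hl'] at hl
  have hΛ : (0 : ℝ) ≤ Λ * K := by positivity
  have hK₂0 : 0 ≤ K₂ := by positivity
  have hKle : K * a ^ 3 ≤ ((K₁ + K) + Λ * K + K₂) * a ^ 3 := by gcongr; linarith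
  refine ⟨y.1, y.2, hy, (norm_fst_le y).trans (hy1.trans (mul_le_mul_of_nonneg_right (by linarith) ha0.le)),
    (norm_fst_le (y - x a)).trans (hyx.trans hKle),
    (norm_snd_le (y - x a)).trans (hyx.trans hKle), ?_⟩
  have h5 := norm_sub_le_norm_sub_add_norm_sub (waveSource p m (a, y)) (waveSource p m (a, x a))
    (approxSource p m c₂ a)
  have h6 := hsrc a ha1
  have h7 : (Λ : ℝ) * ‖y - x a‖ ≤ Λ * K * a ^ 3 := by
    rw [mul_assoc]; gcongr
  have h8 : 0 ≤ (K₁ + K) * a ^ 3 := by positivity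
  calc ‖waveSource p m (a, y) - approxSource p m c₂ a‖ ≤ Λ * K * a ^ 3 + K₂ * a ^ 3 := by linarith
    _ ≤ _ := by linarith

/-! ### Regularity and error bounds for the profile -/

/-- A smooth even `2π`-periodic non-constant solution of `2 u'' = c u - u ^ (p + 1)`. -/
structure IsWaveProfile (p : ℕ) (c : ℝ) (u : ℝ → ℝ) : Prop where
  smooth : ContDiff ℝ ∞ u
  even : ∀ s, u (-s) = u s
  periodic : Function.Periodic u (2 * Real.pi)
  equation : ∀ s, 2 * iteratedDeriv 2 u s = c * u s - u s ^ (p + 1)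
  ne : u 0 ≠ u Real.pi

/-- `g` is bounded by `δ`, and so are its first two derivatives on `[-4π, 4π]`. -/
structure IsSmallProfile (g : ℝ → ℝ) (δ : ℝ) : Prop where
  contDiff : ContDiff ℝ 2 g
  abs_le : ∀ s, |g s| ≤ δ
  abs_iteratedDeriv_le : ∀ k ≤ 2, ∀ s, |s| ≤ 4 * Real.pi → |iteratedDeriv k g s| ≤ δ

theorem iteratedDeriv_two_eq {g g' g'' : ℝ → ℝ} (h1 : ∀ s, HasDerivAt g (g' s) s)
    (h2 : ∀ s, HasDerivAt g' (g'' s) s) : iteratedDeriv 2 g = g'' := by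
  rw [iteratedDeriv_succ, iteratedDeriv_one, funext fun s => (h1 s).deriv,
    funext fun s => (h2 s).deriv]

theorem contDiff_one_of_hasDerivAt {g g' : ℝ → ℝ} {n : ℕ} (h1 : ∀ s, HasDerivAt g (g' s) s)
    (hg : ContDiff ℝ n g') : ContDiff ℝ (n + 1) g := by
  refine contDiff_succ_iff_deriv.2 ⟨fun s => (h1 s).differentiableAt, by simp, ?_⟩
  rwa [funext fun s => (h1 s).deriv]

theorem IsSmallProfile.of_hasDerivAt {g g' g'' : ℝ → ℝ} {δ : ℝ}
    (h1 : ∀ s, HasDerivAt g (g' s) s) (h2 : ∀ s, HasDerivAt g' (g'' s) s) (hc : Continuous g'')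
    (b0 : ∀ s, |g s| ≤ δ) (b1 : ∀ s, |s| ≤ 4 * Real.pi → |g' s| ≤ δ) (b2 : ∀ s, |g'' s| ≤ δ) :
    IsSmallProfile g δ := by
  refine ⟨?_, b0, fun k hk s hs => ?_⟩
  · have := contDiff_one_of_hasDerivAt (n := 1) h1
      (by simpa using contDiff_one_of_hasDerivAt (n := 0) h2 (contDiff_zero.2 hc))
    norm_num at this
    exact this
  · interval_cases k
    · simpa using b0 s
    · rw [iteratedDeriv_one, (h1 s).deriv]
      exact b1 s hs
    · rw [iteratedDeriv_two_eq h1 h2]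
      exact b2 s

theorem IsSmallProfile.add {g h : ℝ → ℝ} {δ ε : ℝ} (hg : IsSmallProfile g δ)
    (hh : IsSmallProfile h ε) : IsSmallProfile (fun s => g s + h s) (δ + ε) := by
  refine ⟨hg.contDiff.add hh.contDiff, fun s => (abs_add_le _ _).trans
    (add_le_add (hg.abs_le s) (hh.abs_le s)), fun k hk s hs => ?_⟩
  have hk' : ((k : ℕ) : WithTop ℕ∞) ≤ 2 := by exact_mod_cast hk
  have : iteratedDeriv k (fun s => g s + h s) s = iteratedDeriv k g s + iteratedDeriv k h s :=
    iteratedDeriv_add (hg.contDiff.of_le hk').contDiffAt (hh.contDiff.of_le hk').contDiffAt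
  rw [this]
  exact (abs_add_le _ _).trans
    (add_le_add (hg.abs_iteratedDeriv_le k hk s hs) (hh.abs_iteratedDeriv_le k hk s hs))

theorem IsSmallProfile.mono {g : ℝ → ℝ} {δ ε : ℝ} (hg : IsSmallProfile g δ) (h : δ ≤ ε) :
    IsSmallProfile g ε :=
  ⟨hg.contDiff, fun s => (hg.abs_le s).trans h,
    fun k hk s hs => (hg.abs_iteratedDeriv_le k hk s hs).trans h⟩

theorem isSmallProfile_const_mul_cos_three (b : ℝ) :
    IsSmallProfile (fun s => b * Real.cos (3 * s)) (9 * |b|) := by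
  have hb := abs_nonneg b
  have hsin : ∀ s, |b| * |Real.sin (3 * s)| ≤ |b| := fun s =>
    mul_le_of_le_one_right hb (Real.abs_sin_le_one _)
  have hcos : ∀ s, |b| * |Real.cos (3 * s)| ≤ |b| := fun s =>
    mul_le_of_le_one_right hb (Real.abs_cos_le_one _)
  refine IsSmallProfile.of_hasDerivAt (g' := fun s => -3 * b * Real.sin (3 * s))
    (g'' := fun s => -9 * b * Real.cos (3 * s)) (fun s => ?_) (fun s => ?_) (by fun_prop)
    (fun s => ?_) (fun s _ => ?_) (fun s => ?_)
  · refine ((((hasDerivAt_id s).const_mul 3).cos).const_mul b).congr_deriv ?_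
    simp only [id]
    ring
  · refine ((((hasDerivAt_id s).const_mul 3).sin).const_mul (-3 * b)).congr_deriv ?_
    simp only [id]
    ring
  · rw [abs_mul]
    linarith [hcos s]
  · rw [abs_mul, abs_mul]
    norm_num
    linarith [hsin s]
  · rw [abs_mul, abs_mul]
    norm_num
    linarith [hcos s]

/-- Bootstrap: if u and u' are Cⁿ, then so are their derivatives u' and Φ(u). -/
theorem contDiff_of_second_order_equation {u u' : ℝ → ℝ} {Φ : ℝ → ℝ} (hΦ : ContDiff ℝ ∞ Φ)
    (h1 : ∀ s, HasDerivAt u (u' s) s) (h2 : ∀ s, HasDerivAt u' (Φ (u s)) s) :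
    ContDiff ℝ ∞ u := by
  have key : ∀ n : ℕ, ContDiff ℝ n u ∧ ContDiff ℝ n u' := by
    intro n
    induction n with
    | zero =>
      exact ⟨contDiff_zero.2 (continuous_iff_continuousAt.2 fun s => (h1 s).continuousAt),
        contDiff_zero.2 (continuous_iff_continuousAt.2 fun s => (h2 s).continuousAt)⟩
    | succ n ih =>
      push_cast
      exact ⟨contDiff_one_of_hasDerivAt h1 ih.2,
        contDiff_one_of_hasDerivAt h2 ((hΦ.of_le (by exact_mod_cast le_top)).comp ih.1)⟩
  exact contDiff_infty.2 fun n => (key n).1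

section profile

variable {p : ℕ} {m c₂ a δ : ℝ} {w : CosSpace}

theorem cosCoeff_waveSource (h : waveMap p m c₂ (a, w, δ) = 0) :
    cosCoeff (waveSource p m (a, w, δ)) = 0 := by
  have h2 : cosCoeff (waveForcing p m (a, w, δ)) = 0 := congrArg Prod.snd h
  simp [waveSource, cosCoeff_one, h2]

theorem onCircle_eq_of_waveMap_eq_zero (h : waveMap p m c₂ (a, w, δ) = 0) (s : ℝ) :
    onCircle w s = onCircle (approxProfile p m c₂ a) 0 * Real.cos s +
      duhamel (onCircle (waveSource p m (a, w, δ))) s := by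
  have h1 : w - onCircle (approxProfile p m c₂ a) 0 • cosVar -
      duhamelCLM (waveSource p m (a, w, δ)) = 0 := congrArg Prod.fst h
  rw [← onCircle_duhamelCLM (cosCoeff_waveSource h)]
  have h3 := congrArg (onCircle · s) h1
  simp only [onCircle_sub, onCircle_smul, onCircle_cosVar, onCircle_zero] at h3
  linarith

theorem isWaveProfile_of_waveMap_eq_zero (hm : p * m ^ p = 2) (ha : 0 < a) (hw : ‖w‖ < 1)
    (h : waveMap p m c₂ (a, w, δ) = 0) :
    IsWaveProfile p (m ^ p + a * δ) (fun s => m + a * (Real.cos s + onCircle w s)) := by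
  set H := waveSource p m (a, w, δ) with hH
  set β := onCircle (approxProfile p m c₂ a) 0
  have hcH := continuous_onCircle H
  have hwave := onCircle_eq_of_waveMap_eq_zero h
  have h1 : ∀ s, HasDerivAt (fun s => m + a * (Real.cos s + onCircle w s))
      (a * (-Real.sin s + (β * -Real.sin s + duhamelDeriv (onCircle H) s))) s := fun s => by
    rw [funext hwave]
    exact (((Real.hasDerivAt_cos s).add (((Real.hasDerivAt_cos s).const_mul β).add
      (hasDerivAt_duhamel hcH s))).const_mul a).const_add m
  have h2 : ∀ s, HasDerivAt
      (fun s => a * (-Real.sin s + (β * -Real.sin s + duhamelDeriv (onCircle H) s)))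
      (((m ^ p + a * δ) * (m + a * (Real.cos s + onCircle w s)) -
        (m + a * (Real.cos s + onCircle w s)) ^ (p + 1)) / 2) s := fun s => by
    refine (((Real.hasDerivAt_sin s).neg.add (((Real.hasDerivAt_sin s).neg.const_mul β).add
      (hasDerivAt_duhamelDeriv hcH s))).const_mul a).congr_deriv ?_
    have h3 := hwave s
    have h4 : onCircle H s = 1 / 2 * (δ * m + a * (δ * (Real.cos s + onCircle w s) -
        onCircle (powerTail p m a (cosVar + w)) s)) := by
      simp [hH, waveSource, waveForcing]
      ring
    have h5 := pow_eq_add_powerTail (p := p) m a (cosVar + w) s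
    rw [onCircle_add, onCircle_cosVar] at h5
    rw [h5]
    linear_combination a * h4 + a * h3 + a / 2 * (Real.cos s + onCircle w s) * hm
  refine ⟨contDiff_of_second_order_equation (Φ := fun x => ((m ^ p + a * δ) * x - x ^ (p + 1)) / 2)
    (by fun_prop) h1 h2, fun s => ?_, fun s => ?_, fun s => ?_, ?_⟩
  · simp only [Real.cos_neg, onCircle_neg_arg]
  · simp only [Real.cos_add_two_pi, onCircle_periodic w s]
  · rw [iteratedDeriv_two_eq h1 h2]
    ring
  · have h0 := abs_le.1 (abs_onCircle_le w 0)
    have h7 := abs_le.1 (abs_onCircle_le w Real.pi)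
    simp only [Real.cos_zero, Real.cos_pi]
    intro h8
    have h9 : a * (1 + onCircle w 0) = a * (-1 + onCircle w Real.pi) := by linarith
    have := mul_left_cancel₀ ha.ne' h9
    linarith [h0.1, h7.2]

/-- The exact and the approximate profile have the same value at 0, so their difference is the
Duhamel integral of the difference of sources. The factor 8π is 2|s| at |s| = 4π. -/
theorem isSmallProfile_sub_approxProfile {ε : ℝ} (ha : 0 < a)
    (h : waveMap p m c₂ (a, w, δ) = 0) (h1 : ‖w - approxProfile p m c₂ a‖ ≤ ε)
    (h2 : ‖waveSource p m (a, w, δ) - approxSource p m c₂ a‖ ≤ ε) :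
    IsSmallProfile (fun s => a * onCircle (w - approxProfile p m c₂ a) s)
      (a * (8 * Real.pi * ε)) := by
  set H := waveSource p m (a, w, δ) - approxSource p m c₂ a with hH
  set D := w - approxProfile p m c₂ a with hD
  have hε : 0 ≤ ε := (norm_nonneg _).trans h1
  have hπ := Real.two_le_pi
  have hcH := continuous_onCircle H
  have hco : cosCoeff H = 0 := by
    rw [hH, map_sub, cosCoeff_waveSource h, cosCoeff_approxSource, sub_zero]
  have hDH : ∀ s, onCircle D s = duhamel (onCircle H) s := by
    intro s
    have h3 : w - onCircle (approxProfile p m c₂ a) 0 • cosVar -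
      duhamelCLM (waveSource p m (a, w, δ)) = 0 := congrArg Prod.fst h
    rw [← onCircle_duhamelCLM hco, hH, map_sub, duhamelCLM_approxSource, ← sub_eq_zero.1 h3, hD]
    congr 1
    abel
  have hDb : ∀ s, |onCircle D s| ≤ ε := fun s => (abs_onCircle_le D s).trans h1
  have hHb : ∀ s, |onCircle H s| ≤ ε := fun s => (abs_onCircle_le H s).trans h2
  have hπε : 2 * ε ≤ 8 * Real.pi * ε := by nlinarith
  refine IsSmallProfile.of_hasDerivAt (g' := fun s => a * duhamelDeriv (onCircle H) s)
    (g'' := fun s => a * (onCircle H s - duhamel (onCircle H) s)) (fun s => ?_)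
    (fun s => (hasDerivAt_duhamelDeriv hcH s).const_mul a)
    (continuous_const.mul (hcH.sub (continuous_duhamel hcH))) (fun s => ?_) (fun s hs => ?_)
    (fun s => ?_)
  · rw [funext hDH]
    exact (hasDerivAt_duhamel hcH s).const_mul a
  · rw [abs_mul, abs_of_pos ha]
    gcongr
    linarith [hDb s]
  · rw [abs_mul, abs_of_pos ha]
    gcongr
    refine (abs_duhamelDeriv_le hHb s).trans ?_
    nlinarith
  · rw [abs_mul, abs_of_pos ha, ← hDH]
    gcongr
    exact (abs_sub _ _).trans (by linarith [hHb s, hDb s])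

end profile

/-- The approximation of the wave profile up to third order in the amplitude `a`. -/
noncomputable def approxWave (p : ℕ) (m c₂ a s : ℝ) : ℝ :=
  m + a * Real.cos s + a ^ 2 * (meanCoeff p m c₂ + secondCoeff p m * Real.cos (2 * s)) +
    a ^ 3 * (thirdCoeff p m * Real.cos (3 * s))

theorem exists_wave_profiles {p : ℕ} {m c₂ : ℝ} (hp : p ≠ 0) (hm : p * m ^ p = 2)
    (hc : c₂ = 2 * binomCoeff p m 2 * (meanCoeff p m c₂ + secondCoeff p m / 2) +
      3 / 4 * binomCoeff p m 3) :
    ∃ a₀ > (0 : ℝ), a₀ ≤ 1 ∧ ∃ K ≥ (0 : ℝ), ∀ a ∈ Set.Ioo 0 a₀, ∃ (c : ℝ) (u : ℝ → ℝ),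
      IsWaveProfile p c u ∧ |c - (2 / p + c₂ * a ^ 2)| ≤ K * a ^ 4 ∧
      IsSmallProfile (fun s => u s - approxWave p m c₂ a s) (K * a ^ 4) := by
  have hp' : (p : ℝ) ≠ 0 := by exact_mod_cast hp
  have hb : binomCoeff p m 2 * m = p + 1 := by
    have h1 : m ^ (p + 1 - 2) * m = m ^ p := by
      rw [← pow_succ]
      congr 1
      omega
    rw [binomCoeff, mul_assoc, h1, Nat.cast_choose_two]
    push_cast
    linear_combination (p + 1) / 2 * hm
  obtain ⟨a₀, ha₀, ha₀', K, hK, hsol⟩ := exists_wave_profile hp hb hc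
  have hπ := Real.two_le_pi
  -- The bound 1/(K + 1) gives ‖w‖ ≤ K·a < 1, so that w cannot cancel the gap of 2 between cos 0 and
  -- cos π.
  refine ⟨min a₀ (1 / (K + 1)), by positivity, (min_le_left _ _).trans ha₀', 8 * Real.pi * K,
    by positivity, fun a ha => ?_⟩
  obtain ⟨w, δ, hz, hw, hw', hδ, hs⟩ := hsol a ⟨ha.1, ha.2.trans_le (min_le_left _ _)⟩
  have ha0 : 0 < a := ha.1
  have haK : a * (K + 1) < 1 := (lt_div_iff₀ (by positivity)).1 (ha.2.trans_le (min_le_right _ _))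
  refine ⟨m ^ p + a * δ, _, isWaveProfile_of_waveMap_eq_zero hm ha0 (by nlinarith) hz, ?_, ?_⟩
  · have h1 : m ^ p + a * δ - (2 / p + c₂ * a ^ 2) = a * (δ - c₂ * a) := by
      field_simp
      linear_combination hm
    rw [h1, abs_mul, abs_of_pos ha0]
    calc a * |δ - c₂ * a| ≤ a * (K * a ^ 3) := by gcongr
      _ = K * a ^ 4 := by ring
      _ ≤ 8 * Real.pi * K * a ^ 4 := by gcongr; nlinarith
  · convert isSmallProfile_sub_approxProfile ha0 hz hw' hs using 1
    · funext s
      simp only [onCircle_sub, onCircle_approxProfile, approxWave]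
      ring
    · ring

/-! ### From profiles to waves in the plane -/

/-- The linear functional `z ↦ z 0 + σ z 1`. -/
noncomputable def phase (σ : ℝ) : Plane →L[ℝ] ℝ :=
  EuclideanSpace.proj (0 : Fin 2) + σ • EuclideanSpace.proj (1 : Fin 2)

theorem phase_apply (σ : ℝ) (z : Plane) : phase σ z = z 0 + σ * z 1 := rfl

theorem norm_phase_le {σ : ℝ} (hσ : |σ| = 1) : ‖phase σ‖ ≤ 2 := by
  refine ContinuousLinearMap.opNorm_le_bound _ (by norm_num) fun z => ?_
  have h0 := PiLp.norm_apply_le z 0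
  have h1 := PiLp.norm_apply_le z 1
  rw [phase_apply]
  refine (norm_add_le _ _).trans ?_
  rw [norm_mul, Real.norm_eq_abs σ, hσ, one_mul]
  linarith

theorem laplacian_comp_phase {σ : ℝ} (hσ : |σ| = 1) {u : ℝ → ℝ} (hu : ContDiff ℝ 2 u)
    (z : Plane) : Laplacian.laplacian (u ∘ phase σ) z = 2 * iteratedDeriv 2 u (phase σ z) := by
  have hσ2 : σ * σ = 1 := by rw [← abs_mul_abs_self, hσ, one_mul]
  have h0 : phase σ (EuclideanSpace.single 0 1) = 1 := by simp [phase_apply]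
  have h1 : phase σ (EuclideanSpace.single 1 1) = σ := by simp [phase_apply]
  rw [InnerProductSpace.laplacian_eq_iteratedFDeriv_orthonormalBasis _
    (EuclideanSpace.basisFun (Fin 2) ℝ)]
  simp only [(phase σ).iteratedFDeriv_comp_right hu z (i := 2) le_rfl, Fin.sum_univ_two,
    ContinuousMultilinearMap.compContinuousLinearMap_apply,
    iteratedFDeriv_apply_eq_iteratedDeriv_mul_prod, Fin.prod_univ_two, smul_eq_mul,
    EuclideanSpace.basisFun_apply, Matrix.cons_val_zero, Matrix.cons_val_one, h0, h1, hσ2]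
  ring

theorem IsWaveProfile.isEvenPeriodicWave {p : ℕ} {c σ : ℝ} {u : ℝ → ℝ} (hu : IsWaveProfile p c u)
    (hσ : σ = 1 ∨ σ = -1) : IsEvenPeriodicWave p c (u ∘ phase σ) := by
  have habs : |σ| = 1 := by rcases hσ with rfl | rfl <;> simp
  refine ⟨hu.smooth.comp (phase σ).contDiff, fun i z => ?_, fun z => ?_, fun z => ?_⟩
  · simp only [Function.comp_apply, map_add]
    fin_cases i
    · have : phase σ (EuclideanSpace.single 0 (2 * Real.pi)) = 2 * Real.pi := by
        simp [phase_apply]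
      simp only [Fin.zero_eta, this]
      exact hu.periodic _
    · have : phase σ (EuclideanSpace.single 1 (2 * Real.pi)) = σ * (2 * Real.pi) := by
        simp [phase_apply]
      simp only [Fin.mk_one, this]
      rcases hσ with rfl | rfl
      · rw [one_mul]
        exact hu.periodic _
      · rw [neg_one_mul, ← sub_eq_add_neg]
        exact hu.periodic.sub_eq _
  · simp only [Function.comp_apply, map_neg, hu.even]
  · rw [laplacian_comp_phase habs (contDiff_infty.1 hu.smooth 2), hu.equation]
    simp only [Function.comp_apply]
    ring

theorem IsWaveProfile.comp_phase_ne {p : ℕ} {c : ℝ} {u : ℝ → ℝ} (hu : IsWaveProfile p c u) :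
    u ∘ phase 1 ≠ u ∘ phase (-1) := by
  intro h
  -- At (π/2, π/2) the two phases are π and 0.
  have := congrFun h (WithLp.toLp 2 ![Real.pi / 2, Real.pi / 2])
  simp only [Function.comp_apply, phase_apply] at this
  norm_num at this
  exact hu.ne this.symm

theorem volume_periodCell_lt_top : MeasureTheory.volume periodCell < ⊤ := by
  refine lt_of_le_of_lt (MeasureTheory.measure_mono (t := Metric.closedBall 0 (4 * Real.pi))
    fun z hz => ?_) MeasureTheory.measure_closedBall_lt_top
  have hπ := Real.pi_pos
  have h0 := hz 0
  have h1 := hz 1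
  rw [mem_closedBall_zero_iff, EuclideanSpace.norm_eq, Fin.sum_univ_two]
  refine Real.sqrt_le_iff.2 ⟨by positivity, ?_⟩
  rw [Real.norm_of_nonneg h0.1, Real.norm_of_nonneg h1.1]
  nlinarith [h0.1, h0.2, h1.1, h1.2]

/-- On the cell the phase stays in [−4π, 4π]. Since the phase has norm at most 2, the squared H²
norm is at most (1 + 4 + 16)·V·δ², where V is the area of the cell. -/
theorem IsSmallProfile.isWithin {g : ℝ → ℝ} {δ σ : ℝ} (hg : IsSmallProfile g δ) (hσ : |σ| = 1) :
    IsWithin (g ∘ phase σ) ((21 * MeasureTheory.volume.real periodCell + 1) * δ) := by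
  set V := MeasureTheory.volume.real periodCell with hV
  have hV0 : 0 ≤ V := MeasureTheory.measureReal_nonneg
  have hδ : 0 ≤ δ := (abs_nonneg _).trans (hg.abs_le 0)
  refine ⟨fun z => (hg.abs_le _).trans (by nlinarith), ?_⟩
  have hk : ∀ k ≤ 2, (∫ z in periodCell, ‖iteratedFDeriv ℝ k (g ∘ phase σ) z‖ ^ 2) ≤
      (δ * 2 ^ k) ^ 2 * V := by
    intro k hk
    refine (Real.le_norm_self _).trans
      (MeasureTheory.norm_setIntegral_le_of_norm_le_const volume_periodCell_lt_top fun z hz => ?_)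
    have hz0 := hz 0
    have hz1 := hz 1
    have hs : |phase σ z| ≤ 4 * Real.pi := by
      rw [phase_apply]
      refine (abs_add_le _ _).trans ?_
      rw [abs_mul, hσ, abs_of_nonneg hz0.1, abs_of_nonneg hz1.1]
      linarith [hz0.2, hz1.2]
    rw [norm_pow, norm_norm]
    gcongr
    rw [(phase σ).iteratedFDeriv_comp_right hg.contDiff z (by exact_mod_cast hk)]
    refine (ContinuousMultilinearMap.norm_compContinuousLinearMap_le _ _).trans ?_
    rw [norm_iteratedFDeriv_eq_norm_iteratedDeriv, Finset.prod_const, Finset.card_univ,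
      Fintype.card_fin]
    have h1 := hg.abs_iteratedDeriv_le k hk _ hs
    have h2 := norm_phase_le hσ
    gcongr
    exact h1
  refine Real.sqrt_le_iff.2 ⟨by positivity, ?_⟩
  simp only [Finset.sum_range_succ, Finset.sum_range_zero, zero_add]
  have e0 := hk 0 (by norm_num)
  have e1 := hk 1 (by norm_num)
  have e2 := hk 2 (by norm_num)
  have h3 : 0 ≤ V * δ ^ 2 := by positivity
  have h4 : 0 ≤ V ^ 2 * δ ^ 2 := by positivity
  nlinarith [sq_nonneg δ]

theorem exists_plane_waves {p n : ℕ} {γ : ℝ → ℝ} {e : ℝ → ℝ → ℝ}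
    (H : ∃ a₀ > (0 : ℝ), ∃ K ≥ (0 : ℝ), ∀ a ∈ Set.Ioo 0 a₀, ∃ (c : ℝ) (u : ℝ → ℝ),
      IsWaveProfile p c u ∧ |c - γ a| ≤ K * a ^ 4 ∧
      IsSmallProfile (fun s => u s - e a s) (K * a ^ n)) :
    ∃ a₀ > (0 : ℝ), ∃ (K : ℝ) (c : ℝ → ℝ) (φp φm : ℝ → Plane → ℝ),
      ∀ a ∈ Set.Ioo 0 a₀,
        IsEvenPeriodicWave p (c a) (φp a) ∧
        IsEvenPeriodicWave p (c a) (φm a) ∧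
        φp a ≠ φm a ∧
        IsWithin (fun z => φp a z - e a (phase 1 z)) (K * a ^ n) ∧
        IsWithin (fun z => φm a z - e a (phase (-1) z)) (K * a ^ n) ∧
        |c a - γ a| ≤ K * a ^ 4 := by
  obtain ⟨a₀, ha₀, K, hK, h⟩ := H
  choose! c u hu hc hs using h
  set V := MeasureTheory.volume.real periodCell
  have hV0 : 0 ≤ V := MeasureTheory.measureReal_nonneg
  refine ⟨a₀, ha₀, (21 * V + 1) * K, c, fun a => u a ∘ phase 1, fun a => u a ∘ phase (-1),
    fun a ha => ⟨(hu a ha).isEvenPeriodicWave (.inl rfl), (hu a ha).isEvenPeriodicWave (.inr rfl),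
      (hu a ha).comp_phase_ne, ?_, ?_, (hc a ha).trans ?_⟩⟩
  · rw [mul_assoc]
    exact (hs a ha).isWithin (by simp)
  · rw [mul_assoc]
    exact (hs a ha).isWithin (by simp)
  · have : 0 ≤ K * a ^ 4 := by positivity
    nlinarith

/-! ### Explicit coefficients and conclusion -/

theorem approxWave_one (a s : ℝ) : approxWave 1 2 (5 / 12) a s =
    2 + a * Real.cos s + a ^ 2 / 6 * (1 + 1 / 2 * Real.cos (2 * s)) +
      1 / 192 * a ^ 3 * Real.cos (3 * s) := by
  norm_num [approxWave, meanCoeff, secondCoeff, thirdCoeff, binomCoeff, Nat.choose]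
  ring

theorem choose_three_cast (p : ℕ) :
    (((p + 1).choose 3 : ℕ) : ℝ) = (p + 1) * p * (p - 1) / 6 := by
  induction p with
  | zero => simp [Nat.choose]
  | succ k ih =>
    rw [Nat.choose_succ_succ, Nat.cast_add, ih, Nat.cast_choose_two]
    push_cast
    ring

theorem rpow_div_eq_pow {p : ℕ} (hp : p ≠ 0) (k : ℕ) :
    (2 / (p : ℝ)) ^ ((k : ℝ) / p) = ((2 / (p : ℝ)) ^ (1 / (p : ℝ))) ^ k := by
  rw [← Real.rpow_natCast, ← Real.rpow_mul (by positivity)]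
  congr 1
  ring

theorem proposition4 :
    (∃ a₀ > (0 : ℝ), ∃ (K : ℝ) (c : ℝ → ℝ) (φp φm : ℝ → Plane → ℝ),
      ∀ a ∈ Set.Ioo 0 a₀,
        IsEvenPeriodicWave 1 (c a) (φp a) ∧
        IsEvenPeriodicWave 1 (c a) (φm a) ∧
        φp a ≠ φm a ∧
        IsWithin (fun z => φp a z - expansionOne 1 a z) (K * a ^ 4) ∧
        IsWithin (fun z => φm a z - expansionOne (-1) a z) (K * a ^ 4) ∧
        |c a - (2 + 5 / 12 * a ^ 2)| ≤ K * a ^ 4) ∧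
    (∀ p : ℕ, 2 ≤ p →
      ∃ a₀ > (0 : ℝ), ∃ (K : ℝ) (c : ℝ → ℝ) (φp φm : ℝ → Plane → ℝ),
      ∀ a ∈ Set.Ioo 0 a₀,
        IsEvenPeriodicWave p (c a) (φp a) ∧
        IsEvenPeriodicWave p (c a) (φm a) ∧
        φp a ≠ φm a ∧
        IsWithin (fun z => φp a z - expansionGen p 1 a z) (K * a ^ 3) ∧
        IsWithin (fun z => φm a z - expansionGen p (-1) a z) (K * a ^ 3) ∧
        |c a - (2 / (p : ℝ) + frequencyCoeff p * a ^ 2)| ≤ K * a ^ 4) := by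
  constructor
  · obtain ⟨a₀, ha₀, -, K, hK, h⟩ := exists_wave_profiles (p := 1) (m := 2) (c₂ := 5 / 12)
      one_ne_zero (by norm_num)
      (by norm_num [meanCoeff, secondCoeff, binomCoeff, Nat.choose])
    have hexp : ∀ σ a z, expansionOne σ a z = approxWave 1 2 (5 / 12) a (phase σ z) := by
      intro σ a z
      rw [approxWave_one, expansionOne, phase_apply,
        show 2 * (z 0 + σ * z 1) = 2 * z 0 + σ * (2 * z 1) by ring,
        show 3 * (z 0 + σ * z 1) = 3 * z 0 + σ * (3 * z 1) by ring]
    simp only [hexp]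
    refine exists_plane_waves (γ := fun a => 2 + 5 / 12 * a ^ 2) ⟨a₀, ha₀, K, hK, fun a ha => ?_⟩
    simpa using h a ha
  · intro p hp
    have hp0 : p ≠ 0 := by omega
    have hp' : (p : ℝ) ≠ 0 := by exact_mod_cast hp0
    set m : ℝ := (2 / (p : ℝ)) ^ (1 / (p : ℝ)) with hm
    have hmp : p * m ^ p = 2 := by
      rw [hm, ← rpow_div_eq_pow hp0, div_self hp', Real.rpow_one]
      field_simp
    have hm1 : (2 / (p : ℝ)) ^ (((p : ℝ) - 1) / p) = m ^ (p - 1) := by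
      rw [hm, ← rpow_div_eq_pow hp0, Nat.cast_sub (by omega), Nat.cast_one]
    have hm2 : (2 / (p : ℝ)) ^ (((p : ℝ) - 2) / p) = m ^ (p - 2) := by
      rw [hm, ← rpow_div_eq_pow hp0, Nat.cast_sub hp, Nat.cast_two]
    have hm3 : (2 / (p : ℝ)) ^ (2 * ((p : ℝ) - 1) / p) = (m ^ (p - 1)) ^ 2 := by
      rw [← pow_mul, hm, ← rpow_div_eq_pow hp0]
      push_cast [Nat.cast_sub (show 1 ≤ p by omega)]
      ring_nf
    have hb2 : binomCoeff p m 2 = (p + 1) * p / 2 * m ^ (p - 1) := by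
      rw [binomCoeff, Nat.cast_choose_two, show p + 1 - 2 = p - 1 by omega]
      push_cast
      ring
    have hb3 : binomCoeff p m 3 = (p + 1) * p * (p - 1) / 6 * m ^ (p - 2) := by
      rw [binomCoeff, choose_three_cast, show p + 1 - 3 = p - 2 by omega]
    have hmm : m ^ (p - 1) * m = m ^ p := by
      rw [← pow_succ]
      congr 1
      omega
    have hc : frequencyCoeff p = 2 * binomCoeff p m 2 *
        (meanCoeff p m (frequencyCoeff p) + secondCoeff p m / 2) + 3 / 4 * binomCoeff p m 3 := by
      have hbm : binomCoeff p m 2 * m = p + 1 := by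
        rw [hb2, mul_assoc, hmm]
        linear_combination (p + 1) / 2 * hmp
      -- This is `hc` solved for c₂: as (binomCoeff p m 2)·m = p + 1, the terms in c₂ combine to
      -- p·c₂.
      have hf : p * frequencyCoeff p =
          5 / 12 * binomCoeff p m 2 ^ 2 - 3 / 4 * binomCoeff p m 3 := by
        rw [frequencyCoeff, hm2, hm3, hb2, hb3]
        ring
      rw [meanCoeff, secondCoeff]
      linear_combination -hf - frequencyCoeff p * hbm
    obtain ⟨a₀, ha₀, ha₀', K, hK, h⟩ := exists_wave_profiles hp0 hmp hc
    set C := thirdCoeff p m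
    have hexp : ∀ σ a z, expansionGen p σ a z =
        approxWave p m (frequencyCoeff p) a (phase σ z) -
          a ^ 3 * C * Real.cos (3 * phase σ z) := by
      intro σ a z
      rw [approxWave, expansionGen, phase_apply,
        show 2 * (z 0 + σ * z 1) = 2 * z 0 + σ * (2 * z 1) by ring, meanCoeff, secondCoeff, hm1,
        Nat.cast_choose_two, hb2, ← hm]
      push_cast
      ring
    simp only [hexp]
    -- The third harmonic goes into the O(a³) error. The 9 comes from its second derivative.
    refine exists_plane_waves (γ := fun a => 2 / (p : ℝ) + frequencyCoeff p * a ^ 2)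
      (e := fun a s => approxWave p m (frequencyCoeff p) a s - a ^ 3 * C * Real.cos (3 * s))
      ⟨a₀, ha₀, K + 9 * |C|, by positivity, fun a ha => ?_⟩
    have ha0 : 0 < a := ha.1
    have ha1 : a ≤ 1 := (ha.2.trans_le ha₀').le
    obtain ⟨c, u, hu, hcu, hs⟩ := h a ha
    refine ⟨c, u, hu, hcu.trans (by gcongr; linarith [abs_nonneg C]), ?_⟩
    have h43 : a ^ 4 ≤ a ^ 3 := pow_le_pow_of_le_one ha0.le ha1 (by norm_num)
    convert (hs.add (isSmallProfile_const_mul_cos_three (a ^ 3 * C))).mono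
      (ε := (K + 9 * |C|) * a ^ 3) ?_ using 1
    · funext s
      ring
    · rw [abs_mul, abs_of_pos (by positivity : 0 < a ^ 3)]
      nlinarith
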